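/- **Setting.** Let $\mathcal X\subset\mathbb R^d$ be compact, let $N\ge 0$, and let $k_0,\dots,k_N:\mathbb R^d\times\mathbb R^d\to\mathbb R$ be measurable kernels with $\sup_{z\in\mathcal X}k_i(z,z)<\infty$ (for instance continuous kernels), with reproducing kernel Hilbert spaces $\mathcal H_{k_i}$. Let $f\in\mathcal H_{k_0}$ and $g_i\in\mathcal H_{k_i}$, $i\in[N]=\{1,\dots,N\}$, satisfy $\|f\|_{k_0}\le B_0$ and $\|g_i\|_{k_i}\le B_i$; write $h_0=f$, $h_i=g_i$. Assume that the problem $\min_{x\in\mathcal X}f(x)$ subject to $g_i(x)\le 0$ for all $i\in[N]$ is feasible and has an optimal solution $x^*$, with value $f^*=f(x^*)$. At step $t\ge1$ a point $x_t$ is queried and $y_{i,t}=h_i(x_t)+\nu_{i,t}$, $0\le i\le N$, is observed. There is a filtration $(\mathcal F_t)_{t\ge0}$ such that $\nu_{i,t}$ is $\mathcal F_t$-measurable, independent of $\mathcal F_{t-1}$ and $\sigma$-sub-Gaussian, i.e. $\mathbb E\,e^{s\nu_{i,t}}\le e^{\sigma^2s^2/2}$ for all $s\in\mathbb R$, and $x_t$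 is $\mathcal F_{t-1}$-measurable. (This holds for i.i.d. $\sigma$-sub-Gaussian noise and queries measurably determined by the past.) Fix $\lambda\ge 1$ and $\delta\in(0,1)$. For $n\ge 0$ let $K_{i,n}=(k_i(x_a,x_b))_{a,b\le n}$, $k_i(x_{1:n},z)=(k_i(x_a,z))_{a\le n}$, $$\mu_{i,n}(z)=k_i(x_{1:n},z)^\top(K_{i,n}+\lambda I)^{-1}y_{i,1:n},$$ $$\sigma_{i,n}^2(z)=k_i(z,z)-k_i(x_{1:n},z)^\top(K_{i,n}+\lambda I)^{-1}k_i(x_{1:n},z),$$ $$\gamma_{i,n}=\sup_{(a_1,\dots,a_n)\in\mathcal X^n}\tfrac12\log\det\bigl(I+\lambda^{-1}(k_i(a_p,a_q))_{p,q\le n}\bigr),$$ and for $t\ge1$ let $$\beta_{i,t}^{1/2}=B_i+\sigma\sqrt{2\bigl(\gamma_{i,t-1}+1+\ln((N+1)/\delta)\bigr)},\qquad l_{i,t}(z)=\mu_{i,t-1}(z)-\beta_{i,t}^{1/2}\sigma_{i,t-1}(z).$$ **Algorithm.** At step $t$, infeasibility is declared if for some $i\in[N]$ one has $l_{i,t}(z)>0$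 for all $z\in\mathcal X$ (i.e. $\min_{\mathcal X}l_{i,t}>0$ when the minimum is attained). As long as infeasibility has not been declared, $x_t$ is a solution of the auxiliary problem $\min_{z\in\mathcal X}l_{0,t}(z)$ subject to $l_{i,t}(z)\le0$ for all $i\in[N]$, provided this problem is feasible. **Lemma.** With probability at least $1-\delta$ the following holds for all $t\ge1$: infeasibility is not declared at step $t$; $x_t$ is a solution of the auxiliary problem; and the regret $r_t=f(x_t)-f^*$, the positive regret $r_t^+=\max\{f(x_t)-f^*,0\}$ and the violations $v_{i,t}=\max\{g_i(x_t),0\}$ satisfy $$r_t\le r_t^+\le 2\beta_{0,t}^{1/2}\sigma_{0,t-1}(x_t),\qquad v_{i,t}\le 2\beta_{i,t}^{1/2}\sigma_{i,t-1}(x_t)\quad\text{for all } i\in[N].$$ -/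

import Mathlib

open scoped MeasureTheory

namespace CONFIG

open scoped Matrix

/-- The candidate space `ℝ^d` with its Euclidean structure. -/
abbrev Pt (d : ℕ) : Type := EuclideanSpace ℝ (Fin d)

/-- `H` is the (real, scalar valued) reproducing kernel Hilbert space of the kernel `k`:
Mathlib's operator valued kernel of `H`, read as a scalar kernel, is `k`. -/
def IsRKHSOf {d : ℕ} (H : Type*) [NormedAddCommGroup H] [InnerProductSpace ℝ H] [CompleteSpace H]
    [RKHS ℝ H (Pt d) ℝ] (k : Pt d → Pt d → ℝ) : Prop :=
  ∀ z z' : Pt d, RKHS.kernel H z z' 1 = k z z'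

/-- The Gram matrix `(k (X a) (X b))_{a,b}` of a finite sequence of points. -/
def gram {d n : ℕ} (k : Pt d → Pt d → ℝ) (X : Fin n → Pt d) : Matrix (Fin n) (Fin n) ℝ :=
  Matrix.of fun a b => k (X a) (X b)

/-- The vector `[k (X 1) z, …, k (X n) z]ᵀ`. -/
def kvec {d n : ℕ} (k : Pt d → Pt d → ℝ) (X : Fin n → Pt d) (z : Pt d) : Fin n → ℝ :=
  fun a => k (X a) z

/-- The first `n` terms `s 1, …, s n` of a sequence indexed by the steps `1, 2, …`. -/
def firstN {α : Type*} (s : ℕ → α) (n : ℕ) : Fin n → α :=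
  fun a => s (a.val + 1)

/-- Posterior mean after the observations `y 1, …, y n` at `x 1, …, x n`. -/
noncomputable def postMean {d : ℕ} (k : Pt d → Pt d → ℝ) (lam : ℝ) (x : ℕ → Pt d) (y : ℕ → ℝ)
    (n : ℕ) (z : Pt d) : ℝ :=
  kvec k (firstN x n) z ⬝ᵥ
    ((gram k (firstN x n) + lam • (1 : Matrix (Fin n) (Fin n) ℝ))⁻¹ *ᵥ firstN y n)

/-- Posterior covariance after observations at `x 1, …, x n`. -/
noncomputable def postCov {d : ℕ} (k : Pt d → Pt d → ℝ) (lam : ℝ) (x : ℕ → Pt d)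
    (n : ℕ) (z z' : Pt d) : ℝ :=
  k z z' - kvec k (firstN x n) z ⬝ᵥ
    ((gram k (firstN x n) + lam • (1 : Matrix (Fin n) (Fin n) ℝ))⁻¹ *ᵥ kvec k (firstN x n) z')

/-- Posterior standard deviation after observations at `x 1, …, x n`. -/
noncomputable def postStd {d : ℕ} (k : Pt d → Pt d → ℝ) (lam : ℝ) (x : ℕ → Pt d)
    (n : ℕ) (z : Pt d) : ℝ :=
  √(postCov k lam x n z z)

/-- Maximum information gain: the supremum, over `n` points of `𝒳` (repetitions allowed, since
a point may be queried several times), of `½ log det (I + lam⁻¹ K_X)`. -/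
noncomputable def maxInfoGain {d : ℕ} (k : Pt d → Pt d → ℝ) (lam : ℝ) (𝒳 : Set (Pt d))
    (n : ℕ) : ℝ :=
  sSup {r : ℝ | ∃ X : Fin n → Pt d, (∀ a, X a ∈ 𝒳) ∧
    r = 1 / 2 * Real.log (1 + lam⁻¹ • gram k X).det}

/-- The confidence multiplier `β_t^{1/2} = B + σ √(2 (γ_{t-1} + 1 + ln ((N + 1) / δ)))`
of one of the `N + 1` functions, used at step `t ≥ 1`. -/
noncomputable def sqrtBeta {d : ℕ} (N : ℕ) (k : Pt d → Pt d → ℝ) (lam : ℝ) (𝒳 : Set (Pt d))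
    (B σ δ : ℝ) (t : ℕ) : ℝ :=
  B + σ * √(2 * (maxInfoGain k lam 𝒳 (t - 1) + 1 + Real.log (((N : ℝ) + 1) / δ)))

/-- The lower confidence bound `l_t(z) = μ_{t-1}(z) - β_t^{1/2} σ_{t-1}(z)` at step `t ≥ 1`. -/
noncomputable def lcb {d : ℕ} (N : ℕ) (k : Pt d → Pt d → ℝ) (lam : ℝ) (𝒳 : Set (Pt d))
    (B σ δ : ℝ) (x : ℕ → Pt d) (y : ℕ → ℝ) (t : ℕ) (z : Pt d) : ℝ :=
  postMean k lam x y (t - 1) z - sqrtBeta N k lam 𝒳 B σ δ t * postStd k lam x (t - 1) z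

/-- Infeasibility is declared when `min_{z ∈ 𝒳} l_i(z) > 0` for some constraint `i`.
Index `0` is the objective, the indices `i.succ` are the constraints. -/
def Declares {d N : ℕ} (𝒳 : Set (Pt d)) (l : Fin (N + 1) → Pt d → ℝ) : Prop :=
  ∃ i : Fin N, ∀ z ∈ 𝒳, 0 < l i.succ z

/-- The feasible set of the problem `min_{z ∈ 𝒳} h_0(z)` subject to `h_i(z) ≤ 0`. -/
def feasibleSet {d N : ℕ} (𝒳 : Set (Pt d)) (h : Fin (N + 1) → Pt d → ℝ) : Set (Pt d) :=
  {z | z ∈ 𝒳 ∧ ∀ i : Fin N, h i.succ z ≤ 0}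

/-- The set of optimal solutions of `min_{z ∈ 𝒳} h_0(z)` subject to `h_i(z) ≤ 0`. -/
def solutionSet {d N : ℕ} (𝒳 : Set (Pt d)) (h : Fin (N + 1) → Pt d → ℝ) : Set (Pt d) :=
  {z | z ∈ feasibleSet 𝒳 h ∧ ∀ w ∈ feasibleSet 𝒳 h, h 0 z ≤ h 0 w}

/-- The lower confidence bounds of all `N + 1` functions at step `t`, computed from the query
points `x` and the observations `y`. -/
noncomputable def lcbs {d N : ℕ} (k : Fin (N + 1) → Pt d → Pt d → ℝ) (lam : ℝ) (𝒳 : Set (Pt d))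
    (B : Fin (N + 1) → ℝ) (σ δ : ℝ) (x : ℕ → Pt d) (y : Fin (N + 1) → ℕ → ℝ) (t : ℕ) :
    Fin (N + 1) → Pt d → ℝ :=
  fun i => lcb N (k i) lam 𝒳 (B i) σ δ x (y i) t

/-- `x 1, x 2, …` are query points of the algorithm fed with the observations `y`: as long as
infeasibility has not been declared, the point queried at step `t` solves the auxiliary problem
built from the lower confidence bounds, provided that problem is feasible.
Nothing is required of `x t` in the steps in which the algorithm makes no query. -/
def IsRun {d N : ℕ} (k : Fin (N + 1) → Pt d → Pt d → ℝ) (lam : ℝ) (𝒳 : Set (Pt d))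
    (B : Fin (N + 1) → ℝ) (σ δ : ℝ) (x : ℕ → Pt d) (y : Fin (N + 1) → ℕ → ℝ) : Prop :=
  ∀ t, 1 ≤ t → (∀ s, 1 ≤ s → s ≤ t → ¬ Declares 𝒳 (lcbs k lam 𝒳 B σ δ x y s)) →
    (feasibleSet 𝒳 (lcbs k lam 𝒳 B σ δ x y t)).Nonempty →
    x t ∈ solutionSet 𝒳 (lcbs k lam 𝒳 B σ δ x y t)

/-- The regret of querying `z` when the optimal value is `fstar`. -/
def regret {d : ℕ} (f : Pt d → ℝ) (fstar : ℝ) (z : Pt d) : ℝ := f z - fstar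

/-- The positive regret. -/
noncomputable def posRegret {d : ℕ} (f : Pt d → ℝ) (fstar : ℝ) (z : Pt d) : ℝ :=
  max (f z - fstar) 0

/-- The violation of the constraint `g ≤ 0` at `z`. -/
noncomputable def violation {d : ℕ} (g : Pt d → ℝ) (z : Pt d) : ℝ := max (g z) 0

end CONFIG

/-! The proof combines optimism with a confidence bound. If every h_i lies within β_i^{1/2} σ_i of
its posterior mean, then l_i ≤ h_i, so x* remains feasible for the auxiliary problem and
infeasibility cannot be declared. Moreover f(x_t) ≤ l_0(x_t) + 2β_0^{1/2}σ_0 ≤ l_0(x*) +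
2β_0^{1/2}σ_0 ≤ f* + 2β_0^{1/2}σ_0, and l_i(x_t) ≤ 0 bounds the violations in the same way.

For the confidence bound, let φ be a feature map of the kernel and A = Σ φ(x_a) ⊗ φ(x_a) + lam. The
estimation error at z is lam⟪φ z, A⁻¹ f⟫ - ⟪φ z, A⁻¹ S⟫ with S = Σ ν_a φ(x_a). Cauchy–Schwarz for
the form of A⁻¹ (`abs_sub_postMean_le`) leaves only ⟪S, A⁻¹ S⟫, the `noiseEnergy`, to be controlled.

The process exp(`logMix`) is a supermartingale: each new factor is the average of exp((ν g -
g²/2)/σ²) over a Gaussian g whose parameters depend on the past, and for fixed g sub-Gaussianity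
bounds the mean by 1 (`lintegral_mul_exp_mixIncr_le`). `ville_inequality` makes the bound uniform in
time; a union bound over the N + 1 functions remains. -/

namespace CONFIG

open scoped Matrix RealInnerProductSpace

/-! ### Ridge regression in feature space: resolvent, rank-one updates, determinants. -/

section RidgeRegression

variable {H : Type*} [NormedAddCommGroup H] [InnerProductSpace ℝ H] {n : ℕ}

/-- The regularized covariance operator `w ↦ ∑ₐ ⟪vₐ, w⟫ vₐ + lam w` of finitely many features. -/
noncomputable def regCov (lam : ℝ) (v : Fin n → H) (w : H) : H :=
  ∑ a, ⟪v a, w⟫ • v a + lam • w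

/-- The inverse of the regularized covariance operator, expressed through the Gram matrix. -/
noncomputable def resolvent (lam : ℝ) (v : Fin n → H) : H →ₗ[ℝ] H :=
  lam⁻¹ • (LinearMap.id - Fintype.linearCombination ℝ v ∘ₗ
    ((Matrix.gram ℝ v + lam • (1 : Matrix (Fin n) (Fin n) ℝ))⁻¹).mulVecLin ∘ₗ
      LinearMap.pi fun a => innerₛₗ ℝ (v a))

lemma resolvent_apply (lam : ℝ) (v : Fin n → H) (w : H) :
    resolvent lam v w = lam⁻¹ • (w - ∑ a,
      ((Matrix.gram ℝ v + lam • (1 : Matrix (Fin n) (Fin n) ℝ))⁻¹ *ᵥ fun a => ⟪v a, w⟫) a • v a) := by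
  simp only [resolvent, LinearMap.smul_apply, LinearMap.sub_apply, LinearMap.id_apply,
    LinearMap.comp_apply, Fintype.linearCombination_apply, Matrix.mulVecLin_apply]
  rfl

lemma posDef_gram_add {lam : ℝ} (hlam : 0 < lam) (v : Fin n → H) :
    (Matrix.gram ℝ v + lam • (1 : Matrix (Fin n) (Fin n) ℝ)).PosDef :=
  Matrix.PosDef.posSemidef_add (Matrix.posSemidef_gram ℝ v) (Matrix.PosDef.one.smul hlam)

lemma isUnit_det_gram_add {lam : ℝ} (hlam : 0 < lam) (v : Fin n → H) :
    IsUnit (Matrix.gram ℝ v + lam • (1 : Matrix (Fin n) (Fin n) ℝ)).det :=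
  isUnit_iff_ne_zero.2 (posDef_gram_add hlam v).det_pos.ne'

lemma inner_sum_smul_eq_gram_mulVec (v : Fin n → H) (c : Fin n → ℝ) :
    (fun a => ⟪v a, ∑ b, c b • v b⟫) = Matrix.gram ℝ v *ᵥ c := by
  ext a
  simp [Matrix.mulVec, dotProduct, inner_sum, inner_smul_right, Matrix.gram_apply, mul_comm]

lemma regCov_resolvent {lam : ℝ} (hlam : 0 < lam) (v : Fin n → H) (w : H) :
    regCov lam v (resolvent lam v w) = w := by
  set G := Matrix.gram ℝ v + lam • (1 : Matrix (Fin n) (Fin n) ℝ) with hG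
  set b : Fin n → ℝ := fun a => ⟪v a, w⟫ with hb
  set c := G⁻¹ *ᵥ b with hc
  have hGc : G *ᵥ c = b := by
    rw [hc, Matrix.mulVec_mulVec, Matrix.mul_nonsing_inv _ (isUnit_det_gram_add hlam v),
      Matrix.one_mulVec]
  have hR : resolvent lam v w = lam⁻¹ • (w - ∑ a, c a • v a) := resolvent_apply lam v w
  -- Since (gram + lam) c = b, pairing w - Σ c_b v_b with v_a gives b_a - (gram c)_a = lam c_a.
  have hcoef : ∀ a, ⟪v a, resolvent lam v w⟫ = c a := by
    intro a
    have h1 : (Matrix.gram ℝ v *ᵥ c) a + lam * c a = b a := by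
      have := congrFun hGc a
      simpa [hG, Matrix.add_mulVec, Matrix.smul_mulVec] using this
    rw [← inner_sum_smul_eq_gram_mulVec] at h1
    rw [hR, inner_smul_right, inner_sub_right]
    change lam⁻¹ * (b a - _) = _
    rw [← h1]
    field_simp
    ring
  simp only [regCov, hcoef]
  rw [hR, smul_inv_smul₀ hlam.ne']
  abel

lemma inner_regCov (lam : ℝ) (v : Fin n → H) (u w : H) :
    ⟪u, regCov lam v w⟫ = ∑ a, ⟪v a, u⟫ * ⟪v a, w⟫ + lam * ⟪u, w⟫ := by
  simp only [regCov, inner_add_right, inner_sum, inner_smul_right]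
  congr 1
  exact Finset.sum_congr rfl fun a _ => by rw [real_inner_comm u, mul_comm]

lemma regCov_symm (lam : ℝ) (v : Fin n → H) (u w : H) :
    ⟪regCov lam v u, w⟫ = ⟪u, regCov lam v w⟫ := by
  rw [real_inner_comm, inner_regCov, inner_regCov, real_inner_comm u w]
  congr 1
  exact Finset.sum_congr rfl fun a _ => mul_comm _ _

lemma regCov_coercive (lam : ℝ) (v : Fin n → H) (w : H) :
    lam * ‖w‖ ^ 2 ≤ ⟪w, regCov lam v w⟫ := by
  rw [inner_regCov, real_inner_self_eq_norm_sq]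
  exact le_add_of_nonneg_left (Finset.sum_nonneg fun a _ => mul_self_nonneg _)

lemma regCov_sub (lam : ℝ) (v : Fin n → H) (u w : H) :
    regCov lam v (u - w) = regCov lam v u - regCov lam v w := by
  simp only [regCov, inner_sub_right, sub_smul, Finset.sum_sub_distrib, smul_sub]
  abel

lemma regCov_smul (lam : ℝ) (v : Fin n → H) (c : ℝ) (w : H) :
    regCov lam v (c • w) = c • regCov lam v w := by
  simp only [regCov, inner_smul_right, smul_add, Finset.smul_sum, smul_smul, mul_comm lam c]

/-- Coercivity makes `regCov` injective, so the right inverse is two-sided even when H is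
infinite-dimensional. -/
lemma resolvent_eq_of_regCov_eq {lam : ℝ} (hlam : 0 < lam) (v : Fin n → H) {u w : H}
    (h : regCov lam v u = w) : resolvent lam v w = u := by
  have h0 : regCov lam v (resolvent lam v w - u) = 0 := by
    rw [regCov_sub, regCov_resolvent hlam, h, sub_self]
  have := regCov_coercive lam v (resolvent lam v w - u)
  rw [h0, inner_zero_right] at this
  have h2 : ‖resolvent lam v w - u‖ ^ 2 ≤ 0 := nonpos_of_mul_nonpos_right this hlam
  exact sub_eq_zero.1 (norm_eq_zero.1 (pow_eq_zero_iff two_ne_zero |>.1 (h2.antisymm (sq_nonneg _))))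

lemma resolvent_symm {lam : ℝ} (hlam : 0 < lam) (v : Fin n → H) (u w : H) :
    ⟪u, resolvent lam v w⟫ = ⟪w, resolvent lam v u⟫ := by
  conv_lhs => rw [← regCov_resolvent hlam v u]
  rw [regCov_symm, regCov_resolvent hlam, real_inner_comm]

lemma mul_norm_resolvent_sq_le {lam : ℝ} (hlam : 0 < lam) (v : Fin n → H) (u : H) :
    lam * ‖resolvent lam v u‖ ^ 2 ≤ ⟪u, resolvent lam v u⟫ := by
  have := regCov_coercive lam v (resolvent lam v u)
  rwa [regCov_resolvent hlam, real_inner_comm] at this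

lemma inner_resolvent_nonneg {lam : ℝ} (hlam : 0 < lam) (v : Fin n → H) (u : H) :
    0 ≤ ⟪u, resolvent lam v u⟫ :=
  le_trans (by positivity) (mul_norm_resolvent_sq_le hlam v u)

lemma inner_resolvent_le {lam : ℝ} (hlam : 0 < lam) (v : Fin n → H) (u : H) :
    lam * ⟪u, resolvent lam v u⟫ ≤ ‖u‖ ^ 2 := by
  have h1 := mul_norm_resolvent_sq_le hlam v u
  have h2 := real_inner_le_norm u (resolvent lam v u)
  nlinarith [sq_nonneg (‖u‖ - lam * ‖resolvent lam v u‖)]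

lemma inner_resolvent_sq_le {lam : ℝ} (hlam : 0 < lam) (v : Fin n → H) (u w : H) :
    ⟪u, resolvent lam v w⟫ ^ 2 ≤ ⟪u, resolvent lam v u⟫ * ⟪w, resolvent lam v w⟫ := by
  have := LinearMap.BilinForm.apply_sq_le_of_symm ((innerₗ H).compl₂ (resolvent lam v))
    (fun u => inner_resolvent_nonneg hlam v u)
    ⟨fun u w => by simpa using resolvent_symm hlam v u w⟩ u w
  simpa using this

lemma abs_inner_resolvent_le {lam : ℝ} (hlam : 0 < lam) (v : Fin n → H) (u w : H) :
    |⟪u, resolvent lam v w⟫| ≤ √⟪u, resolvent lam v u⟫ * √⟪w, resolvent lam v w⟫ := by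
  rw [← Real.sqrt_mul (inner_resolvent_nonneg hlam v u)]
  exact Real.abs_le_sqrt (inner_resolvent_sq_le hlam v u w)

lemma regCov_succ (lam : ℝ) (v : Fin (n + 1) → H) (w : H) :
    regCov lam v w = regCov lam (v ∘ Fin.castSucc) w + ⟪v (Fin.last n), w⟫ • v (Fin.last n) := by
  simp only [regCov, Fin.sum_univ_castSucc, Function.comp_apply]
  abel

/-- The Sherman–Morrison formula. -/
lemma resolvent_succ {lam : ℝ} (hlam : 0 < lam) (v : Fin (n + 1) → H) (w : H) :
    resolvent lam v w = resolvent lam (v ∘ Fin.castSucc) w -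
      (⟪v (Fin.last n), resolvent lam (v ∘ Fin.castSucc) w⟫ /
        (1 + ⟪v (Fin.last n), resolvent lam (v ∘ Fin.castSucc) (v (Fin.last n))⟫)) •
          resolvent lam (v ∘ Fin.castSucc) (v (Fin.last n)) := by
  apply resolvent_eq_of_regCov_eq hlam
  have hq := inner_resolvent_nonneg hlam (v ∘ Fin.castSucc) (v (Fin.last n))
  rw [regCov_succ, regCov_sub, regCov_smul, regCov_resolvent hlam, regCov_resolvent hlam,
    inner_sub_right, inner_smul_right, sub_add, ← sub_smul, sub_eq_self]
  refine smul_eq_zero_of_left ?_ _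
  field_simp
  ring

/-- With S the weighted feature sum of the first n points, this is the exact change of the noise
energy when one observation e is added. -/
lemma inner_resolvent_succ {lam : ℝ} (hlam : 0 < lam) (v : Fin (n + 1) → H) (S : H) (e : ℝ) :
    ⟪S + e • v (Fin.last n), resolvent lam v (S + e • v (Fin.last n))⟫ =
      ⟪S, resolvent lam (v ∘ Fin.castSucc) S⟫ +
        (2 * e * ⟪v (Fin.last n), resolvent lam (v ∘ Fin.castSucc) S⟫ +
          e ^ 2 * ⟪v (Fin.last n), resolvent lam (v ∘ Fin.castSucc) (v (Fin.last n))⟫ -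
          ⟪v (Fin.last n), resolvent lam (v ∘ Fin.castSucc) S⟫ ^ 2) /
        (1 + ⟪v (Fin.last n), resolvent lam (v ∘ Fin.castSucc) (v (Fin.last n))⟫) := by
  have hq := inner_resolvent_nonneg hlam (v ∘ Fin.castSucc) (v (Fin.last n))
  have hs := resolvent_symm hlam (v ∘ Fin.castSucc) S (v (Fin.last n))
  rw [resolvent_succ hlam]
  simp only [map_add, map_smul, inner_add_left, inner_add_right, inner_sub_right,
    inner_smul_left, inner_smul_right, hs, conj_trivial]
  field_simp
  ring

/-- The Schur complement of the leading n × n block is lam times one plus the relative variance of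
the new feature. -/
lemma det_gram_add_succ {lam : ℝ} (hlam : 0 < lam) (v : Fin (n + 1) → H) :
    (Matrix.gram ℝ v + lam • (1 : Matrix (Fin (n + 1)) (Fin (n + 1)) ℝ)).det =
      (Matrix.gram ℝ (v ∘ Fin.castSucc) + lam • (1 : Matrix (Fin n) (Fin n) ℝ)).det *
        (lam * (1 + ⟪v (Fin.last n), resolvent lam (v ∘ Fin.castSucc) (v (Fin.last n))⟫)) := by
  set G := Matrix.gram ℝ (v ∘ Fin.castSucc) + lam • (1 : Matrix (Fin n) (Fin n) ℝ) with hG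
  set φ := v (Fin.last n) with hφ
  set b : Fin n → ℝ := fun a => ⟪v a.castSucc, φ⟫ with hb
  have hblocks : (Matrix.gram ℝ v + lam • (1 : Matrix (Fin (n + 1)) (Fin (n + 1)) ℝ)).submatrix
      (finSumFinEquiv (m := n) (n := 1)) (finSumFinEquiv (m := n) (n := 1)) =
      Matrix.fromBlocks G (Matrix.of fun a _ => b a) (Matrix.of fun _ a => b a)
        (Matrix.of fun _ _ => ⟪φ, φ⟫ + lam) := by
    have hl : ∀ j : Fin 1, Fin.natAdd n j = Fin.last n := fun j => by
      ext; simp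
    have hc : ∀ i : Fin n, Fin.castAdd 1 i = i.castSucc := fun _ => rfl
    ext i j
    rcases i with i | i <;> rcases j with j | j
    · simp [hc, hG, Matrix.gram_apply, Matrix.one_apply]
    · simp [hc, hl, hb, hφ, Matrix.gram_apply, Fin.ext_iff, i.2.ne]
    · simp [hc, hl, hb, hφ, Matrix.gram_apply, Fin.ext_iff, j.2.ne',
        real_inner_comm (v j.castSucc)]
    · simp [hl, hφ, Matrix.gram_apply, Subsingleton.elim i j]
  have : Invertible G := Matrix.invertibleOfIsUnitDet G (isUnit_det_gram_add hlam _)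
  rw [← Matrix.det_submatrix_equiv_self (finSumFinEquiv (m := n) (n := 1)), hblocks,
    Matrix.det_fromBlocks₁₁]
  congr 1
  rw [Matrix.det_unique, resolvent_apply]
  rw [inner_smul_right, inner_sub_right, inner_sum, Matrix.invOf_eq_nonsing_inv]
  have : ∑ a, ⟪φ, (G⁻¹ *ᵥ b) a • (v ∘ Fin.castSucc) a⟫ = b ⬝ᵥ (G⁻¹ *ᵥ b) := by
    refine Finset.sum_congr rfl fun a _ => ?_
    rw [inner_smul_right, mul_comm, real_inner_comm]
    rfl
  have h2 : ((Matrix.of fun (_ : Fin 1) a => b a) * G⁻¹ * (Matrix.of fun a (_ : Fin 1) => b a))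
      default default = b ⬝ᵥ (G⁻¹ *ᵥ b) := by
    rw [Matrix.mul_assoc]
    rfl
  rw [Matrix.sub_apply, h2]
  change _ = lam * (1 + lam⁻¹ * (⟪φ, φ⟫ - ∑ a, ⟪φ, (G⁻¹ *ᵥ b) a • (v ∘ Fin.castSucc) a⟫))
  rw [this, Matrix.of_apply]
  field_simp
  ring

lemma det_one_add_smul_gram {lam : ℝ} (hlam : 0 < lam) (v : Fin n → H) :
    (1 + lam⁻¹ • Matrix.gram ℝ v).det =
      (lam⁻¹) ^ n * (Matrix.gram ℝ v + lam • (1 : Matrix (Fin n) (Fin n) ℝ)).det := by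
  have h : (1 + lam⁻¹ • Matrix.gram ℝ v) =
      lam⁻¹ • (Matrix.gram ℝ v + lam • (1 : Matrix (Fin n) (Fin n) ℝ)) := by
    rw [smul_add, inv_smul_smul₀ hlam.ne', add_comm]
  rw [h, Matrix.det_smul, Fintype.card_fin]

lemma det_one_add_smul_gram_succ {lam : ℝ} (hlam : 0 < lam) (v : Fin (n + 1) → H) :
    (1 + lam⁻¹ • Matrix.gram ℝ v).det = (1 + lam⁻¹ • Matrix.gram ℝ (v ∘ Fin.castSucc)).det *
      (1 + ⟪v (Fin.last n), resolvent lam (v ∘ Fin.castSucc) (v (Fin.last n))⟫) := by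
  rw [det_one_add_smul_gram hlam, det_one_add_smul_gram hlam, det_gram_add_succ hlam,
    pow_succ]
  field_simp

lemma det_one_add_smul_gram_pos {lam : ℝ} (hlam : 0 < lam) (v : Fin n → H) :
    0 < (1 + lam⁻¹ • Matrix.gram ℝ v).det := by
  rw [det_one_add_smul_gram hlam]
  have := (posDef_gram_add hlam v).det_pos
  positivity

/-- The determinant is a product of factors 1 + q, each with q ≤ ‖v_a‖² / lam. This is what makes
the information gain finite. -/
lemma det_one_add_smul_gram_le {lam C : ℝ} (hlam : 0 < lam) (v : Fin n → H)
    (hC : ∀ a, ‖v a‖ ^ 2 ≤ C) : (1 + lam⁻¹ • Matrix.gram ℝ v).det ≤ (1 + lam⁻¹ * C) ^ n := by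
  induction n with
  | zero => simp
  | succ n ih =>
    rw [det_one_add_smul_gram_succ hlam, pow_succ]
    have hq := inner_resolvent_nonneg hlam (v ∘ Fin.castSucc) (v (Fin.last n))
    have hq2 := inner_resolvent_le hlam (v ∘ Fin.castSucc) (v (Fin.last n))
    have hC0 : 0 ≤ C := (sq_nonneg _).trans (hC (Fin.last n))
    refine mul_le_mul (ih _ fun a => hC _) ?_ (by positivity) (by positivity)
    have := hC (Fin.last n)
    rw [inv_mul_eq_div, add_le_add_iff_left, le_div_iff₀ hlam]
    linarith

end RidgeRegression

end CONFIG

namespace CONFIG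

open scoped Matrix RealInnerProductSpace

/-! ### Posterior mean and covariance in terms of the resolvent. -/

section Posterior

variable {d n : ℕ} {H : Type*} [NormedAddCommGroup H] [InnerProductSpace ℝ H]
  {k : Pt d → Pt d → ℝ} {φ : Pt d → H} {lam : ℝ}

lemma gram_eq_gram_comp (hφ : ∀ z z', k z z' = ⟪φ z, φ z'⟫) (X : Fin n → Pt d) :
    gram k X = Matrix.gram ℝ (φ ∘ X) := by
  ext a b
  exact hφ _ _

lemma kvec_eq_inner (hφ : ∀ z z', k z z' = ⟪φ z, φ z'⟫) (X : Fin n → Pt d) (z : Pt d) :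
    kvec k X z = fun a => ⟪(φ ∘ X) a, φ z⟫ := by
  ext a
  exact hφ _ _

lemma postCov_eq_inner_resolvent (hφ : ∀ z z', k z z' = ⟪φ z, φ z'⟫) (hlam : 0 < lam)
    (x : ℕ → Pt d) (n : ℕ) (z z' : Pt d) :
    postCov k lam x n z z' = lam * ⟪φ z, resolvent lam (φ ∘ firstN x n) (φ z')⟫ := by
  rw [postCov, kvec_eq_inner hφ, kvec_eq_inner hφ, gram_eq_gram_comp hφ, resolvent_apply,
    inner_smul_right, mul_inv_cancel_left₀ hlam.ne', inner_sub_right, inner_sum, hφ]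
  congr 1
  refine Finset.sum_congr rfl fun a _ => ?_
  rw [inner_smul_right, mul_comm, real_inner_comm _ (φ z)]

lemma regCov_sum_smul (v : Fin n → H) (c : Fin n → ℝ) :
    regCov lam v (∑ a, c a • v a) =
      ∑ a, ((Matrix.gram ℝ v + lam • (1 : Matrix (Fin n) (Fin n) ℝ)) *ᵥ c) a • v a := by
  have h := inner_sum_smul_eq_gram_mulVec v c
  rw [regCov, Finset.smul_sum, ← Finset.sum_add_distrib]
  refine Finset.sum_congr rfl fun a _ => ?_
  rw [congrFun h a, smul_smul, ← add_smul]
  simp [Matrix.add_mulVec, Matrix.smul_mulVec]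

/-- Push-through identity: it moves the inverse from feature space to the Gram matrix acting on
coefficients. -/
lemma resolvent_sum_smul (hlam : 0 < lam) (v : Fin n → H) (c : Fin n → ℝ) :
    resolvent lam v (∑ a, c a • v a) =
      ∑ a, ((Matrix.gram ℝ v + lam • (1 : Matrix (Fin n) (Fin n) ℝ))⁻¹ *ᵥ c) a • v a := by
  apply resolvent_eq_of_regCov_eq hlam
  rw [regCov_sum_smul, Matrix.mulVec_mulVec, Matrix.mul_nonsing_inv _ (isUnit_det_gram_add hlam v),
    Matrix.one_mulVec]

lemma postMean_eq_inner_resolvent (hφ : ∀ z z', k z z' = ⟪φ z, φ z'⟫) (hlam : 0 < lam)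
    (x : ℕ → Pt d) (y : ℕ → ℝ) (n : ℕ) (z : Pt d) :
    postMean k lam x y n z = ⟪φ z, resolvent lam (φ ∘ firstN x n)
      (∑ a, firstN y n a • (φ ∘ firstN x n) a)⟫ := by
  rw [resolvent_sum_smul hlam, postMean, kvec_eq_inner hφ, gram_eq_gram_comp hφ, inner_sum]
  refine Finset.sum_congr rfl fun a _ => ?_
  rw [inner_smul_right, mul_comm, real_inner_comm _ (φ z)]

/-- The squared norm of the noise in the observations `e`, measured in the norm given by the
inverse of the regularized covariance operator. -/
noncomputable def noiseEnergy (k : Pt d → Pt d → ℝ) (lam : ℝ) (x : ℕ → Pt d) (e : ℕ → ℝ)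
    (n : ℕ) : ℝ :=
  ∑ a, firstN e n a * postMean k lam x e n (firstN x n a)

lemma noiseEnergy_eq_inner_resolvent (hφ : ∀ z z', k z z' = ⟪φ z, φ z'⟫) (hlam : 0 < lam)
    (x : ℕ → Pt d) (e : ℕ → ℝ) (n : ℕ) :
    noiseEnergy k lam x e n = ⟪∑ a, firstN e n a • (φ ∘ firstN x n) a,
      resolvent lam (φ ∘ firstN x n) (∑ a, firstN e n a • (φ ∘ firstN x n) a)⟫ := by
  rw [noiseEnergy, sum_inner]
  refine Finset.sum_congr rfl fun a _ => ?_
  rw [postMean_eq_inner_resolvent hφ hlam, real_inner_smul_left]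
  rfl

lemma postStd_eq (hφ : ∀ z z', k z z' = ⟪φ z, φ z'⟫) (hlam : 0 < lam)
    (x : ℕ → Pt d) (n : ℕ) (z : Pt d) :
    postStd k lam x n z = √lam * √⟪φ z, resolvent lam (φ ∘ firstN x n) (φ z)⟫ := by
  rw [postStd, postCov_eq_inner_resolvent hφ hlam, Real.sqrt_mul hlam.le]

/-- The distance between a function and its ridge regression estimate is controlled by the
norm of the function and the energy of the noise. -/
lemma abs_sub_postMean_le (hφ : ∀ z z', k z z' = ⟪φ z, φ z'⟫) (hlam : 1 ≤ lam)
    (f : H) (x : ℕ → Pt d) (y e : ℕ → ℝ) (n : ℕ)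
    (hy : ∀ a, firstN y n a = ⟪φ (firstN x n a), f⟫ + firstN e n a) (z : Pt d) :
    |⟪φ z, f⟫ - postMean k lam x y n z| ≤
      (‖f‖ + √(noiseEnergy k lam x e n)) * postStd k lam x n z := by
  have hlam0 : 0 < lam := by linarith
  set v := φ ∘ firstN x n with hv
  set S := ∑ a, firstN e n a • v a with hS
  have h1 : ∑ a, firstN y n a • v a = regCov lam v f - lam • f + S := by
    rw [regCov, add_sub_cancel_right, hS, ← Finset.sum_add_distrib]
    refine Finset.sum_congr rfl fun a _ => ?_
    rw [hy, add_smul]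
    rfl
  have h2 : ⟪φ z, f⟫ - postMean k lam x y n z =
      lam * ⟪φ z, resolvent lam v f⟫ - ⟪φ z, resolvent lam v S⟫ := by
    rw [postMean_eq_inner_resolvent hφ hlam0, ← hv, h1, map_add, map_sub, map_smul,
      resolvent_eq_of_regCov_eq hlam0 v rfl, inner_add_right, inner_sub_right, inner_smul_right]
    ring
  set r := √⟪φ z, resolvent lam v (φ z)⟫ with hr
  have hr0 : 0 ≤ r := Real.sqrt_nonneg _
  have hs1 : 1 ≤ √lam := Real.one_le_sqrt.2 hlam
  have hss : √lam * √lam = lam := Real.mul_self_sqrt hlam0.le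
  have hf : √lam * √⟪f, resolvent lam v f⟫ ≤ ‖f‖ := by
    rw [← Real.sqrt_mul hlam0.le]
    exact Real.sqrt_le_iff.2 ⟨norm_nonneg _, inner_resolvent_le hlam0 v f⟩
  have c1 := abs_inner_resolvent_le hlam0 v (φ z) f
  have c2 := abs_inner_resolvent_le hlam0 v (φ z) S
  have hQ : √(noiseEnergy k lam x e n) = √⟪S, resolvent lam v S⟫ := by
    rw [noiseEnergy_eq_inner_resolvent hφ hlam0]
  rw [h2, postStd_eq hφ hlam0, hQ, ← hv, ← hr]
  calc |lam * ⟪φ z, resolvent lam v f⟫ - ⟪φ z, resolvent lam v S⟫|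
      ≤ |lam * ⟪φ z, resolvent lam v f⟫| + |⟪φ z, resolvent lam v S⟫| := abs_sub _ _
    _ ≤ lam * (r * √⟪f, resolvent lam v f⟫) + r * √⟪S, resolvent lam v S⟫ := by
        rw [abs_mul, abs_of_pos hlam0]
        gcongr
    _ = √lam * r * (√lam * √⟪f, resolvent lam v f⟫) + 1 * r * √⟪S, resolvent lam v S⟫ := by
        nth_rewrite 1 [← hss]
        ring
    -- The bound 1 ≤ √lam lets the noise term carry the same factor √lam · r, the posterior standard
    -- deviation, as the bias term.
    _ ≤ √lam * r * ‖f‖ + √lam * r * √⟪S, resolvent lam v S⟫ := by gcongr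
    _ = _ := by ring

lemma postCov_self_nonneg (hφ : ∀ z z', k z z' = ⟪φ z, φ z'⟫) (hlam : 0 < lam)
    (x : ℕ → Pt d) (n : ℕ) (z : Pt d) : 0 ≤ postCov k lam x n z z := by
  rw [postCov_eq_inner_resolvent hφ hlam]
  exact mul_nonneg hlam.le (inner_resolvent_nonneg hlam _ _)

lemma noiseEnergy_succ (hφ : ∀ z z', k z z' = ⟪φ z, φ z'⟫) (hlam : 0 < lam)
    (x : ℕ → Pt d) (e : ℕ → ℝ) (n : ℕ) :
    noiseEnergy k lam x e (n + 1) = noiseEnergy k lam x e n +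
      (2 * e (n + 1) * postMean k lam x e n (x (n + 1)) +
        e (n + 1) ^ 2 * (postCov k lam x n (x (n + 1)) (x (n + 1)) / lam) -
        postMean k lam x e n (x (n + 1)) ^ 2) /
      (1 + postCov k lam x n (x (n + 1)) (x (n + 1)) / lam) := by
  have h := inner_resolvent_succ hlam (φ ∘ firstN x (n + 1))
    (∑ a, firstN e n a • (φ ∘ firstN x n) a) (e (n + 1))
  rw [noiseEnergy_eq_inner_resolvent hφ hlam, noiseEnergy_eq_inner_resolvent hφ hlam,
    postMean_eq_inner_resolvent hφ hlam, postCov_eq_inner_resolvent hφ hlam,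
    mul_div_cancel_left₀ _ hlam.ne', Fin.sum_univ_castSucc]
  exact h

lemma det_gram_succ (hφ : ∀ z z', k z z' = ⟪φ z, φ z'⟫) (hlam : 0 < lam)
    (x : ℕ → Pt d) (n : ℕ) :
    (1 + lam⁻¹ • gram k (firstN x (n + 1))).det = (1 + lam⁻¹ • gram k (firstN x n)).det *
      (1 + postCov k lam x n (x (n + 1)) (x (n + 1)) / lam) := by
  rw [gram_eq_gram_comp hφ, gram_eq_gram_comp hφ, postCov_eq_inner_resolvent hφ hlam,
    mul_div_cancel_left₀ _ hlam.ne', det_one_add_smul_gram_succ hlam]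
  rfl

/-! ### The mixture process and the information gain. -/

/-- The logarithm of the mixture supermartingale for self-normalized noise. -/
noncomputable def logMix (k : Pt d → Pt d → ℝ) (lam s : ℝ) (x : ℕ → Pt d) (e : ℕ → ℝ)
    (n : ℕ) : ℝ :=
  noiseEnergy k lam x e n / (2 * s) - 1 / 2 * Real.log (1 + lam⁻¹ • gram k (firstN x n)).det

/-- The logarithmic increment of the mixture supermartingale, for an observation `e` at a point
with posterior mean `p` and relative variance `q`. -/
noncomputable def mixIncr (s p q e : ℝ) : ℝ :=
  (2 * e * p + e ^ 2 * q - p ^ 2) / (1 + q) / (2 * s) - 1 / 2 * Real.log (1 + q)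

lemma logMix_zero (s : ℝ) (x : ℕ → Pt d) (e : ℕ → ℝ) : logMix k lam s x e 0 = 0 := by
  simp [logMix, noiseEnergy]

lemma logMix_succ (hφ : ∀ z z', k z z' = ⟪φ z, φ z'⟫) (hlam : 0 < lam) (s : ℝ)
    (x : ℕ → Pt d) (e : ℕ → ℝ) (n : ℕ) :
    logMix k lam s x e (n + 1) = logMix k lam s x e n +
      mixIncr s (postMean k lam x e n (x (n + 1)))
        (postCov k lam x n (x (n + 1)) (x (n + 1)) / lam) (e (n + 1)) := by
  have hq : 0 ≤ postCov k lam x n (x (n + 1)) (x (n + 1)) / lam :=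
    div_nonneg (postCov_self_nonneg hφ hlam _ _ _) hlam.le
  have hdet : 0 < (1 + lam⁻¹ • gram k (firstN x n)).det := by
    rw [gram_eq_gram_comp hφ]
    exact det_one_add_smul_gram_pos hlam _
  rw [logMix, logMix, mixIncr, noiseEnergy_succ hφ hlam, det_gram_succ hφ hlam,
    Real.log_mul hdet.ne' (by positivity), add_div]
  ring

/-- Needed because the real `sSup` of an unbounded set is 0, in which case the gain would bound
nothing. -/
lemma bddAbove_infoGain (hφ : ∀ z z', k z z' = ⟪φ z, φ z'⟫) (hlam : 0 < lam) {𝒳 : Set (Pt d)}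
    (hbdd : BddAbove ((fun z => k z z) '' 𝒳)) (n : ℕ) :
    BddAbove {r : ℝ | ∃ X : Fin n → Pt d, (∀ a, X a ∈ 𝒳) ∧
      r = 1 / 2 * Real.log (1 + lam⁻¹ • gram k X).det} := by
  obtain ⟨C, hC⟩ := hbdd
  refine ⟨1 / 2 * Real.log ((1 + lam⁻¹ * C) ^ n), ?_⟩
  rintro _ ⟨X, hX, rfl⟩
  rw [gram_eq_gram_comp hφ]
  have hpos := det_one_add_smul_gram_pos hlam (φ ∘ X)
  gcongr
  refine det_one_add_smul_gram_le hlam _ fun a => ?_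
  rw [← real_inner_self_eq_norm_sq]
  exact (hφ _ _).symm.trans_le (hC ⟨X a, hX a, rfl⟩)

lemma half_log_det_le_maxInfoGain (hφ : ∀ z z', k z z' = ⟪φ z, φ z'⟫) (hlam : 0 < lam)
    {𝒳 : Set (Pt d)} (hbdd : BddAbove ((fun z => k z z) '' 𝒳)) {x : ℕ → Pt d} {n : ℕ}
    (hx : ∀ a, firstN x n a ∈ 𝒳) :
    1 / 2 * Real.log (1 + lam⁻¹ • gram k (firstN x n)).det ≤ maxInfoGain k lam 𝒳 n :=
  le_csSup (bddAbove_infoGain hφ hlam hbdd n) ⟨_, hx, rfl⟩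

lemma sqrt_noiseEnergy_le (hφ : ∀ z z', k z z' = ⟪φ z, φ z'⟫) (hlam : 0 < lam)
    {𝒳 : Set (Pt d)} (hbdd : BddAbove ((fun z => k z z) '' 𝒳)) {x : ℕ → Pt d} {e : ℕ → ℝ} {n : ℕ}
    (hx : ∀ a, firstN x n a ∈ 𝒳) {σ L : ℝ} (hσ : 0 < σ)
    (hmix : logMix k lam (σ ^ 2) x e n ≤ L) :
    √(noiseEnergy k lam x e n) ≤ σ * √(2 * (maxInfoGain k lam 𝒳 n + 1 + L)) := by
  have h := half_log_det_le_maxInfoGain hφ hlam hbdd hx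
  have hE : noiseEnergy k lam x e n ≤ σ ^ 2 * (2 * (maxInfoGain k lam 𝒳 n + 1 + L)) := by
    -- The summand 1 in the multiplier is slack: the bound already holds with gain + L.
    have h1 : noiseEnergy k lam x e n / (2 * σ ^ 2) ≤ maxInfoGain k lam 𝒳 n + 1 + L := by
      rw [logMix] at hmix
      linarith
    rw [div_le_iff₀ (by positivity)] at h1
    linarith
  calc √(noiseEnergy k lam x e n) ≤ √(σ ^ 2 * (2 * (maxInfoGain k lam 𝒳 n + 1 + L))) :=
        Real.sqrt_le_sqrt hE
    _ = _ := by rw [Real.sqrt_mul (sq_nonneg σ), Real.sqrt_sq hσ.le]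

end Posterior

/-! ### Measurability of the posterior quantities. -/

section Measurability

variable {Ω : Type*} [MeasurableSpace Ω] {n : ℕ}

lemma measurable_matrix_det {A : Ω → Matrix (Fin n) (Fin n) ℝ}
    (hA : ∀ i j, Measurable fun ω => A ω i j) : Measurable fun ω => (A ω).det := by
  simp only [Matrix.det_apply']
  fun_prop

/-- Cramer's formula exhibits the entries as quotients of determinants; with division by zero equal
to zero, no invertibility is needed. -/
lemma measurable_matrix_inv {A : Ω → Matrix (Fin n) (Fin n) ℝ}
    (hA : ∀ i j, Measurable fun ω => A ω i j) (i j : Fin n) :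
    Measurable fun ω => (A ω)⁻¹ i j := by
  simp only [Matrix.inv_def, Ring.inverse_eq_inv', Matrix.smul_apply, smul_eq_mul,
    Matrix.adjugate_apply]
  refine (measurable_matrix_det hA).inv.mul (measurable_matrix_det fun a b => ?_)
  simp only [Matrix.updateRow_apply]
  split_ifs
  · exact measurable_const
  · exact hA a b

variable {d : ℕ} {k : Pt d → Pt d → ℝ} {lam : ℝ} {x : ℕ → Ω → Pt d} {e : ℕ → Ω → ℝ}

lemma measurable_kernel_comp (hk : Measurable (Function.uncurry k)) {f g : Ω → Pt d}
    (hf : Measurable f) (hg : Measurable g) : Measurable fun ω => k (f ω) (g ω) :=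
  hk.comp (hf.prodMk hg)

lemma measurable_gram_entry (hk : Measurable (Function.uncurry k))
    (hx : ∀ t < n, Measurable (x (t + 1))) (i j : Fin n) :
    Measurable fun ω => gram k (firstN (fun t => x t ω) n) i j :=
  measurable_kernel_comp hk (hx i i.2) (hx j j.2)

lemma measurable_posterior_inv (hk : Measurable (Function.uncurry k))
    (hx : ∀ t < n, Measurable (x (t + 1))) (i j : Fin n) :
    Measurable fun ω => (gram k (firstN (fun t => x t ω) n) +
      lam • (1 : Matrix (Fin n) (Fin n) ℝ))⁻¹ i j :=
  measurable_matrix_inv (fun a b => (measurable_gram_entry hk hx a b).add_const _) i j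

lemma measurable_postMean (hk : Measurable (Function.uncurry k))
    (hx : ∀ t < n, Measurable (x (t + 1))) (he : ∀ t < n, Measurable (e (t + 1)))
    {g : Ω → Pt d} (hg : Measurable g) :
    Measurable fun ω => postMean k lam (fun t => x t ω) (fun t => e t ω) n (g ω) := by
  simp only [postMean, dotProduct, Matrix.mulVec]
  exact Finset.measurable_sum _ fun a _ => (measurable_kernel_comp hk (hx a a.2) hg).mul
    (Finset.measurable_sum _ fun b _ => (measurable_posterior_inv hk hx a b).mul (he b b.2))

lemma measurable_postCov (hk : Measurable (Function.uncurry k))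
    (hx : ∀ t < n, Measurable (x (t + 1))) {g : Ω → Pt d} (hg : Measurable g) :
    Measurable fun ω => postCov k lam (fun t => x t ω) n (g ω) (g ω) := by
  simp only [postCov, dotProduct, Matrix.mulVec]
  exact (measurable_kernel_comp hk hg hg).sub <|
    Finset.measurable_sum _ fun a _ => (measurable_kernel_comp hk (hx a a.2) hg).mul
      (Finset.measurable_sum _ fun b _ => (measurable_posterior_inv hk hx a b).mul
        (measurable_kernel_comp hk (hx b b.2) hg))

lemma measurable_logMix (hk : Measurable (Function.uncurry k)) (s : ℝ)
    (hx : ∀ t < n, Measurable (x (t + 1))) (he : ∀ t < n, Measurable (e (t + 1))) :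
    Measurable fun ω => logMix k lam s (fun t => x t ω) (fun t => e t ω) n := by
  refine Measurable.sub (Measurable.div_const ?_ _) (Measurable.const_mul ?_ _)
  · exact Finset.measurable_sum _ fun a _ =>
      (he a a.2).mul (measurable_postMean hk hx he (hx a a.2))
  · exact Real.measurable_log.comp (measurable_matrix_det fun a b =>
      ((measurable_gram_entry hk hx a b).const_mul _).const_add _)

end Measurability

end CONFIG

/-! ### Gaussian mixtures and Ville's inequality. -/

namespace CONFIG

open MeasureTheory ProbabilityTheory
open scoped ENNReal NNReal

/-- Heuristically, a Gaussian prior with covariance s/lam on H, tilted by the past noise, gives the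
pairing with the new feature the law N(p, s q). Working with this one-dimensional law avoids
Gaussian measures on H. -/
lemma lintegral_gaussianReal_exp_eq_exp_mixIncr {s q : ℝ≥0} (hs : 0 < s) (p e : ℝ) :
    ∫⁻ g, ENNReal.ofReal (Real.exp ((e * g - g ^ 2 / 2) / s)) ∂(gaussianReal p (s * q)) =
      ENNReal.ofReal (Real.exp (mixIncr s p q e)) := by
  have hs' : (0 : ℝ) < s := by exact_mod_cast hs
  rcases eq_or_ne q 0 with rfl | hq
  -- At zero variance the Gaussian is the Dirac mass at p and has no density.
  · simp only [mul_zero, gaussianReal_zero_var, lintegral_dirac, mixIncr]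
    congr 2
    simp
    field_simp
  have hq' : (0 : ℝ) < q := by exact_mod_cast pos_iff_ne_zero.2 hq
  have hv : s * q ≠ 0 := mul_ne_zero hs.ne' hq
  have hv' : s * q / (1 + q) ≠ 0 := div_ne_zero hv (by positivity)
  rw [gaussianReal_of_var_ne_zero _ hv,
    lintegral_withDensity_eq_lintegral_mul _ (measurable_gaussianPDF _ _) (by fun_prop)]
  -- Completing the square: the tilted density is a constant times the density of mean (e q + p)/(1
  -- + q) and variance s q/(1 + q).
  have key : ∀ g : ℝ, (gaussianPDF p (s * q) *
      fun g => ENNReal.ofReal (Real.exp ((e * g - g ^ 2 / 2) / s))) g =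
      ENNReal.ofReal (Real.exp (mixIncr s p q e)) *
        gaussianPDF ((e * q + p) / (1 + q)) (s * q / (1 + q)) g := by
    intro g
    rw [Pi.mul_apply, gaussianPDF, gaussianPDF, ← ENNReal.ofReal_mul (gaussianPDFReal_nonneg _ _ _),
      ← ENNReal.ofReal_mul (Real.exp_pos _).le]
    congr 1
    have hlog : Real.exp (-(1 / 2 * Real.log (1 + q))) = (√(1 + (q : ℝ)))⁻¹ := by
      rw [Real.exp_neg, one_div_mul_eq_div, Real.exp_half, Real.exp_log (by positivity)]
    have hroot : √(2 * Real.pi * (s * q / (1 + q))) * √(1 + (q : ℝ)) =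
        √(2 * Real.pi * (s * q)) := by
      rw [← Real.sqrt_mul (by positivity)]
      congr 1
      field_simp
    simp only [gaussianPDFReal, mixIncr, NNReal.coe_mul, NNReal.coe_div, NNReal.coe_add,
      NNReal.coe_one]
    rw [sub_eq_add_neg (_ / _) (_ * _), Real.exp_add, hlog, ← hroot, mul_inv, mul_assoc,
      ← Real.exp_add]
    have hexp : -(g - p) ^ 2 / (2 * (s * q)) + (e * g - g ^ 2 / 2) / s =
        (2 * e * p + e ^ 2 * q - p ^ 2) / (1 + q) / (2 * s) +
          -(g - (e * q + p) / (1 + q)) ^ 2 / (2 * (s * q / (1 + q))) := by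
      field_simp
      ring
    rw [hexp, Real.exp_add]
    ring
  simp only [key]
  rw [lintegral_const_mul _ (measurable_gaussianPDF _ _), lintegral_gaussianPDF_eq_one _ hv',
    mul_one]

section Step

variable {Ω : Type*} {mΩ : MeasurableSpace Ω} {P : Measure Ω}

lemma lintegral_exp_mul_sub_le_one {X : Ω → ℝ} {s : ℝ≥0} (hs : 0 < s)
    (hX : HasSubgaussianMGF X s P) (g : ℝ) :
    ∫⁻ ω, ENNReal.ofReal (Real.exp ((X ω * g - g ^ 2 / 2) / s)) ∂P ≤ 1 := by
  have hs' : (0 : ℝ) < s := by exact_mod_cast hs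
  have h : ∀ ω, ENNReal.ofReal (Real.exp ((X ω * g - g ^ 2 / 2) / s)) =
      ENNReal.ofReal (Real.exp (-(g ^ 2 / 2 / s))) * ENNReal.ofReal (Real.exp (g / s * X ω)) := by
    intro ω
    rw [← ENNReal.ofReal_mul (Real.exp_pos _).le, ← Real.exp_add]
    congr 2
    field_simp
    ring
  simp only [h]
  rw [lintegral_const_mul' _ _ ENNReal.ofReal_ne_top,
    ← ofReal_integral_eq_lintegral_ofReal (hX.integrable_exp_mul _)
      (ae_of_all _ fun _ => (Real.exp_pos _).le),
    ← ENNReal.ofReal_mul (Real.exp_pos _).le, ENNReal.ofReal_le_one]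
  calc _ ≤ Real.exp (-(g ^ 2 / 2 / s)) * Real.exp (s * (g / s) ^ 2 / 2) := by
        gcongr
        exact hX.mgf_le _
    _ = 1 := by
        rw [← Real.exp_add, Real.exp_eq_one_iff]
        field_simp
        ring

/-- By Tonelli the noise is integrated out first, for each fixed g. -/
lemma lintegral_exp_mixIncr_le_one [SFinite P] {X : Ω → ℝ} {s : ℝ≥0} (hs : 0 < s)
    (hXm : Measurable X) (hX : HasSubgaussianMGF X s P) (p : ℝ) (q : ℝ≥0) :
    ∫⁻ ω, ENNReal.ofReal (Real.exp (mixIncr s p q (X ω))) ∂P ≤ 1 := by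
  simp only [← lintegral_gaussianReal_exp_eq_exp_mixIncr hs]
  rw [lintegral_lintegral_swap (by fun_prop)]
  calc _ ≤ ∫⁻ _, 1 ∂(gaussianReal p (s * q)) :=
        lintegral_mono fun g => lintegral_exp_mul_sub_le_one hs hX g
    _ = 1 := by simp

lemma measurable_mixIncr {α : Type*} [MeasurableSpace α] (s : ℝ) {p q e : α → ℝ}
    (hp : Measurable p) (hq : Measurable q) (he : Measurable e) :
    Measurable fun a => mixIncr s (p a) (q a) (e a) := by
  unfold mixIncr
  fun_prop

/-- One step of the mixture supermartingale. -/
lemma lintegral_mul_exp_mixIncr_le [IsProbabilityMeasure P] {X p q : Ω → ℝ}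
    {G : Ω → ℝ≥0∞} {s : ℝ≥0} (hs : 0 < s) (hXm : Measurable X) (hX : HasSubgaussianMGF X s P)
    (hG : Measurable G) (hp : Measurable p) (hq : Measurable q) (hq0 : ∀ ω, 0 ≤ q ω)
    (hYX : IndepFun (fun ω => (G ω, p ω, q ω)) X P) :
    ∫⁻ ω, G ω * ENNReal.ofReal (Real.exp (mixIncr s (p ω) (q ω) (X ω))) ∂P ≤ ∫⁻ ω, G ω ∂P := by
  set Y : Ω → ℝ≥0∞ × ℝ × ℝ := fun ω => (G ω, p ω, q ω) with hY
  have hYm : Measurable Y := hG.prodMk (hp.prodMk hq)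
  have hmap := (indepFun_iff_map_prod_eq_prod_map_map hYm.aemeasurable hXm.aemeasurable).1 hYX
  -- The absolute value keeps the variance nonnegative on the whole product space; on the range of Y
  -- it changes nothing.
  set Φ : (ℝ≥0∞ × ℝ × ℝ) × ℝ → ℝ≥0∞ := fun z =>
    z.1.1 * ENNReal.ofReal (Real.exp (mixIncr s z.1.2.1 |z.1.2.2| z.2)) with hΦ
  have hΦm : Measurable Φ := by
    refine Measurable.mul (by fun_prop) (ENNReal.measurable_ofReal.comp
      (Real.measurable_exp.comp (measurable_mixIncr _ (by fun_prop) ?_ (by fun_prop))))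
    exact continuous_abs.measurable.comp (by fun_prop)
  calc ∫⁻ ω, G ω * ENNReal.ofReal (Real.exp (mixIncr s (p ω) (q ω) (X ω))) ∂P
      = ∫⁻ ω, Φ (Y ω, X ω) ∂P := by simp only [hΦ, hY, abs_of_nonneg (hq0 _)]
    _ = ∫⁻ z, Φ z ∂(P.map fun ω => (Y ω, X ω)) := (lintegral_map hΦm (hYm.prodMk hXm)).symm
    _ = ∫⁻ y, ∫⁻ e, Φ (y, e) ∂(P.map X) ∂(P.map Y) := by
        rw [hmap, lintegral_prod _ hΦm.aemeasurable]
    _ ≤ ∫⁻ y, y.1 ∂(P.map Y) := by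
        refine lintegral_mono fun y => ?_
        rw [lintegral_map (f := fun e => Φ (y, e)) (hΦm.comp measurable_prodMk_left) hXm]
        simp only [hΦ]
        have hmeas : Measurable fun ω =>
            ENNReal.ofReal (Real.exp (mixIncr s y.2.1 |y.2.2| (X ω))) :=
          ENNReal.measurable_ofReal.comp (Real.measurable_exp.comp
            (measurable_mixIncr _ measurable_const measurable_const hXm))
        rw [lintegral_const_mul _ hmeas]
        exact mul_le_of_le_one_right' (lintegral_exp_mixIncr_le_one hs hXm hX y.2.1 ⟨_, abs_nonneg _⟩)
    _ = ∫⁻ ω, G ω ∂P := lintegral_map measurable_fst hYm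

/-- **Ville's inequality** for nonnegative supermartingales. -/
lemma ville_inequality (𝓕 : Filtration ℕ mΩ) {G : ℕ → Ω → ℝ≥0∞}
    (hG : ∀ n, Measurable[𝓕 n] (G n))
    (hstep : ∀ n (A : Set Ω), MeasurableSet[𝓕 n] A → ∫⁻ ω in A, G (n + 1) ω ∂P ≤ ∫⁻ ω in A, G n ω ∂P)
    (h0 : ∫⁻ ω, G 0 ω ∂P ≤ 1) (c : ℝ≥0∞) :
    c * P {ω | ∃ n, c ≤ G n ω} ≤ 1 := by
  have hG' : ∀ n, Measurable (G n) := fun n => (hG n).mono (𝓕.le n) le_rfl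
  set D : ℕ → Set Ω := fun n => {ω | ∃ m ≤ n, c ≤ G m ω} with hD
  have hDsucc : ∀ n, D (n + 1) = D n ∪ {ω | c ≤ G (n + 1) ω} := by
    intro n
    ext ω
    simp only [hD, Set.mem_ofPred_eq, Set.mem_union, Nat.le_succ_iff]
    constructor
    · rintro ⟨m, hm | rfl, h⟩
      · exact Or.inl ⟨m, hm, h⟩
      · exact Or.inr h
    · rintro (⟨m, hm, h⟩ | h)
      · exact ⟨m, Or.inl hm, h⟩
      · exact ⟨_, Or.inr rfl, h⟩
  have hDzero : D 0 = {ω | c ≤ G 0 ω} := by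
    ext ω
    simp [hD]
  have hDm : ∀ n, MeasurableSet[𝓕 n] (D n) := by
    intro n
    induction n with
    | zero => rw [hDzero]; exact hG 0 measurableSet_Ici
    | succ n ih =>
      rw [hDsucc]
      exact MeasurableSet.union (𝓕.mono n.le_succ _ ih) (hG (n + 1) measurableSet_Ici)
  have hsplit : ∀ n (E : Set Ω), MeasurableSet E →
      c * P (E ∩ {ω | c ≤ G n ω}) + ∫⁻ ω in E \ {ω | c ≤ G n ω}, G n ω ∂P ≤
        ∫⁻ ω in E, G n ω ∂P := by
    intro n E hE
    have hS : MeasurableSet {ω | c ≤ G n ω} := hG' n measurableSet_Ici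
    rw [← lintegral_inter_add_sdiff (G n) E hS]
    gcongr
    rw [← setLIntegral_const]
    exact setLIntegral_mono (hG' n) fun ω hω => hω.2
  -- This bounds the mean of the process stopped on reaching c, with c as a lower bound for its
  -- value on D n.
  have main : ∀ n, c * P (D n) + ∫⁻ ω in (D n)ᶜ, G n ω ∂P ≤ 1 := by
    intro n
    induction n with
    | zero =>
      have := hsplit 0 Set.univ MeasurableSet.univ
      rw [Set.univ_inter, ← Set.compl_eq_univ_sdiff, setLIntegral_univ] at this
      rw [hDzero]
      exact this.trans h0
    | succ n ih =>
      have hE := 𝓕.le n _ (hDm n).compl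
      have h1 := (hsplit (n + 1) _ hE).trans (hstep n _ (hDm n).compl)
      have h2 : (D (n + 1))ᶜ = (D n)ᶜ \ {ω | c ≤ G (n + 1) ω} := by
        rw [hDsucc, Set.compl_union, Set.sdiff_eq]
      have h3 : P (D (n + 1)) ≤ P (D n) + P ((D n)ᶜ ∩ {ω | c ≤ G (n + 1) ω}) := by
        refine (measure_mono ?_).trans (measure_union_le _ _)
        rw [hDsucc]
        intro ω hω
        by_cases h : ω ∈ D n
        · exact Or.inl h
        · exact Or.inr ⟨h, hω.resolve_left h⟩
      calc c * P (D (n + 1)) + ∫⁻ ω in (D (n + 1))ᶜ, G (n + 1) ω ∂P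
          ≤ c * (P (D n) + P ((D n)ᶜ ∩ {ω | c ≤ G (n + 1) ω})) +
            ∫⁻ ω in (D n)ᶜ \ {ω | c ≤ G (n + 1) ω}, G (n + 1) ω ∂P := by
              rw [h2]
              gcongr
        _ = c * P (D n) + (c * P ((D n)ᶜ ∩ {ω | c ≤ G (n + 1) ω}) +
            ∫⁻ ω in (D n)ᶜ \ {ω | c ≤ G (n + 1) ω}, G (n + 1) ω ∂P) := by
              rw [mul_add, add_assoc]
        _ ≤ _ := (by gcongr : _ ≤ _).trans ih
  have hU : {ω | ∃ n, c ≤ G n ω} = ⋃ n, D n := by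
    ext ω
    simp only [hD, Set.mem_ofPred_eq, Set.mem_iUnion]
    exact ⟨fun ⟨n, h⟩ => ⟨n, n, le_rfl, h⟩, fun ⟨_, m, _, h⟩ => ⟨m, h⟩⟩
  have hmono : Monotone D := fun a b hab ω ⟨m, hm, h⟩ => ⟨m, hm.trans hab, h⟩
  rw [hU, hmono.measure_iUnion, ENNReal.mul_iSup]
  exact iSup_le fun n => le_self_add.trans (main n)

end Step

/-! ### Time-uniform self-normalized concentration. -/

section Concentration

open scoped RealInnerProductSpace

variable {d : ℕ} {H : Type*} [NormedAddCommGroup H] [InnerProductSpace ℝ H]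
  {k : Pt d → Pt d → ℝ} {φ : Pt d → H} {lam : ℝ}
  {Ω : Type*} {mΩ : MeasurableSpace Ω} {P : Measure Ω} [IsProbabilityMeasure P]
  {𝓕 : Filtration ℕ mΩ} {ν : ℕ → Ω → ℝ} {x : ℕ → Ω → Pt d}

/-- The self-normalized concentration inequality, uniformly over time. -/
lemma mul_measure_exists_logMix_ge_le_one (hφ : ∀ z z', k z z' = ⟪φ z, φ z'⟫) (hlam : 0 < lam)
    (hk : Measurable (Function.uncurry k)) {s : ℝ≥0} (hs : 0 < s)
    (hν : ∀ t, Measurable[𝓕 (t + 1)] (ν (t + 1)))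
    (hind : ∀ t, Indep (MeasurableSpace.comap (ν (t + 1)) inferInstance) (𝓕 t) P)
    (hsub : ∀ t, HasSubgaussianMGF (ν (t + 1)) s P)
    (hx : ∀ t, Measurable[𝓕 t] (x (t + 1))) (c : ℝ≥0∞) :
    c * P {ω | ∃ n, c ≤ ENNReal.ofReal
      (Real.exp (logMix k lam s (fun t => x t ω) (fun t => ν t ω) n))} ≤ 1 := by
  have hx' : ∀ n, ∀ t < n, Measurable[𝓕 n] (x (t + 1)) := fun n t ht =>
    (hx t).mono (𝓕.mono ht.le) le_rfl
  have hν' : ∀ n, ∀ t < n, Measurable[𝓕 n] (ν (t + 1)) := fun n t ht =>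
    (hν t).mono (𝓕.mono ht) le_rfl
  have hG : ∀ n, Measurable[𝓕 n] fun ω => ENNReal.ofReal
      (Real.exp (logMix k lam s (fun t => x t ω) (fun t => ν t ω) n)) := fun n =>
    ENNReal.measurable_ofReal.comp (Real.measurable_exp.comp
      (@measurable_logMix Ω (𝓕 n) n d k lam x ν hk s (hx' n) (hν' n)))
  refine ville_inequality 𝓕 hG (fun n A hA => ?_) (by simp [logMix_zero]) c
  have hA' : MeasurableSet A := 𝓕.le n _ hA
  -- The indicator of A is absorbed into the past factor G, so independence from the past replaces
  -- conditional expectations.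
  rw [← lintegral_indicator hA', ← lintegral_indicator hA']
  have hν'' : Measurable[mΩ] (ν (n + 1)) := (hν n).mono (𝓕.le _) le_rfl
  have h1 := (hG n).indicator hA
  have h2 := @measurable_postMean Ω (𝓕 n) n d k lam x ν hk (hx' n) (hν' n) _ (hx n)
  have h3 := (@measurable_postCov Ω (𝓕 n) n d k lam x hk (hx' n) _ (hx n)).div_const lam
  have hY := h1.prodMk (h2.prodMk h3)
  have h := lintegral_mul_exp_mixIncr_le hs hν'' (hsub n) (h1.mono (𝓕.le n) le_rfl)
    (h2.mono (𝓕.le n) le_rfl) (h3.mono (𝓕.le n) le_rfl)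
    (fun ω => div_nonneg (postCov_self_nonneg hφ hlam _ _ _) hlam.le)
    ((IndepFun_iff_Indep _ _ _).2 (indep_of_indep_of_le_right (hind n) hY.comap_le).symm)
  refine le_of_eq_of_le (lintegral_congr fun ω => ?_) h
  by_cases hω : ω ∈ A
  · simp only [Set.indicator_of_mem hω]
    rw [logMix_succ hφ hlam, Real.exp_add, ENNReal.ofReal_mul (Real.exp_pos _).le]
  · simp [Set.indicator_of_notMem hω]

lemma exists_event_sqrt_noiseEnergy_le (hφ : ∀ z z', k z z' = ⟪φ z, φ z'⟫) (hlam : 0 < lam)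
    (hk : Measurable (Function.uncurry k)) {𝒳 : Set (Pt d)}
    (hbdd : BddAbove ((fun z => k z z) '' 𝒳)) (σ : ℝ≥0)
    (hν : ∀ t, Measurable[𝓕 (t + 1)] (ν (t + 1)))
    (hind : ∀ t, Indep (MeasurableSpace.comap (ν (t + 1)) inferInstance) (𝓕 t) P)
    (hsub : ∀ t, HasSubgaussianMGF (ν (t + 1)) (σ ^ 2) P)
    (hx : ∀ t, Measurable[𝓕 t] (x (t + 1))) {c : ℝ} (hc : 0 < c) :
    ∃ A : Set Ω, MeasurableSet A ∧ P Aᶜ ≤ ENNReal.ofReal (1 / c) ∧ ∀ ω ∈ A, ∀ n,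
      (∀ a, firstN (fun t => x t ω) n a ∈ 𝒳) →
        √(noiseEnergy k lam (fun t => x t ω) (fun t => ν t ω) n) ≤
          σ * √(2 * (maxInfoGain k lam 𝒳 n + 1 + Real.log c)) := by
  have hνm : ∀ t, Measurable (ν (t + 1)) := fun t => (hν t).mono (𝓕.le _) le_rfl
  have hxm : ∀ t, Measurable (x (t + 1)) := fun t => (hx t).mono (𝓕.le _) le_rfl
  rcases eq_or_ne σ 0 with rfl | hσ
  -- For σ = 0 the mixture would divide by zero, but the noise vanishes almost surely.
  · refine ⟨⋂ t, {ω | ν (t + 1) ω = 0},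
      MeasurableSet.iInter fun t => hνm t (measurableSet_singleton 0), ?_, fun ω hω n _ => ?_⟩
    · have h0 : ∀ᵐ ω ∂P, ∀ t, ν (t + 1) ω = 0 := ae_all_iff.2 fun t =>
        (by simpa using hsub t : HasSubgaussianMGF (ν (t + 1)) 0 P).ae_eq_zero_of_hasSubgaussianMGF_zero
      have h1 : P (⋂ t, {ω | ν (t + 1) ω = 0})ᶜ = 0 := by
        rw [← mem_ae_iff]
        filter_upwards [h0] with ω hω using Set.mem_iInter.2 hω
      rw [h1]
      exact zero_le
    · have h0 : ∀ t, ν (t + 1) ω = 0 := fun t => Set.mem_iInter.1 hω t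
      have : noiseEnergy k lam (fun t => x t ω) (fun t => ν t ω) n = 0 :=
        Finset.sum_eq_zero fun a _ => mul_eq_zero_of_left (h0 a) _
      simp [this]
  · have hσ0 : 0 < σ := pos_iff_ne_zero.2 hσ
    set S : Set Ω := {ω | ∃ n, ENNReal.ofReal c ≤ ENNReal.ofReal
      (Real.exp (logMix k lam ((σ ^ 2 : ℝ≥0) : ℝ) (fun t => x t ω) (fun t => ν t ω) n))} with hS
    have hSm : MeasurableSet S := by
      rw [hS, Set.ofPred_exists]
      exact MeasurableSet.iUnion fun n => measurableSet_le measurable_const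
        (ENNReal.measurable_ofReal.comp (Real.measurable_exp.comp
          (measurable_logMix hk _ (fun t _ => hxm t) (fun t _ => hνm t))))
    refine ⟨Sᶜ, hSm.compl, ?_, fun ω hω n hX => ?_⟩
    · have h := mul_measure_exists_logMix_ge_le_one hφ hlam hk (pow_pos hσ0 2) hν hind hsub hx
        (ENNReal.ofReal c)
      rw [compl_compl, one_div, ENNReal.ofReal_inv_of_pos hc]
      exact ENNReal.le_inv_iff_mul_le.2 (by rwa [mul_comm])
    · refine sqrt_noiseEnergy_le hφ hlam hbdd hX (NNReal.coe_pos.2 hσ0) ?_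
      have h1 : ¬ ENNReal.ofReal c ≤ ENNReal.ofReal (Real.exp
          (logMix k lam ((σ ^ 2 : ℝ≥0) : ℝ) (fun t => x t ω) (fun t => ν t ω) n)) :=
        fun h => hω ⟨n, h⟩
      rw [ENNReal.ofReal_le_ofReal_iff (Real.exp_pos _).le, not_le] at h1
      rw [NNReal.coe_pow] at h1
      exact (Real.le_log_iff_exp_le hc).2 h1.le

end Concentration

end CONFIG

namespace CONFIG

open MeasureTheory ProbabilityTheory
open scoped ENNReal NNReal RealInnerProductSpace

/-! ### Optimism and the confidence bound in the RKHS. -/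

section Optimism

variable {d N : ℕ} {𝒳 : Set (Pt d)} {h l : Fin (N + 1) → Pt d → ℝ}

/-- Lower bounds of the constraints do not certify infeasibility of a feasible problem. -/
lemma not_declares_of_le (hl : ∀ i z, l i z ≤ h i z) {z : Pt d} (hz : z ∈ feasibleSet 𝒳 h) :
    ¬ Declares 𝒳 l := fun ⟨i, hi⟩ =>
  (hi z hz.1).not_ge ((hl _ _).trans (hz.2 i))

lemma feasibleSet_subset_of_le (hl : ∀ i z, l i z ≤ h i z) :
    feasibleSet 𝒳 h ⊆ feasibleSet 𝒳 l :=
  fun _ hz => ⟨hz.1, fun i => (hl _ _).trans (hz.2 i)⟩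

end Optimism

lemma sqrtBeta_nonneg {d : ℕ} (N : ℕ) (k : Pt d → Pt d → ℝ) (lam : ℝ) (𝒳 : Set (Pt d))
    {B σ : ℝ} (hB : 0 ≤ B) (hσ : 0 ≤ σ) (δ : ℝ) (t : ℕ) : 0 ≤ sqrtBeta N k lam 𝒳 B σ δ t := by
  unfold sqrtBeta
  positivity

section ReproducingKernel

variable {d : ℕ} {H : Type*} [NormedAddCommGroup H] [InnerProductSpace ℝ H] [CompleteSpace H]
  [RKHS ℝ H (Pt d) ℝ] {k : Pt d → Pt d → ℝ}

lemma inner_kerFun_one (z : Pt d) (f : H) : ⟪RKHS.kerFun H z 1, f⟫ = f z := by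
  simp

/-- Supplies the feature map z ↦ `RKHS.kerFun H z 1` to which the ridge regression results are
applied. -/
lemma IsRKHSOf.kernel_eq_inner (hH : IsRKHSOf H k) (z z' : Pt d) :
    k z z' = ⟪RKHS.kerFun H z 1, RKHS.kerFun H z' 1⟫ := by
  rw [inner_kerFun_one, RKHS.kerFun_apply, hH]

/-- The confidence bound that results from a bound for the energy of the noise. -/
lemma abs_sub_postMean_le_sqrtBeta_mul (hH : IsRKHSOf H k) {lam : ℝ} (hlam : 1 ≤ lam) (N : ℕ)
    {𝒳 : Set (Pt d)} {B σ δ : ℝ} {f : H} (hf : ‖f‖ ≤ B) {x : ℕ → Pt d} {y e : ℕ → ℝ} {n : ℕ}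
    (hy : ∀ t < n, y (t + 1) = f (x (t + 1)) + e (t + 1))
    (he : √(noiseEnergy k lam x e n) ≤
      σ * √(2 * (maxInfoGain k lam 𝒳 n + 1 + Real.log (((N : ℝ) + 1) / δ)))) (z : Pt d) :
    |f z - postMean k lam x y n z| ≤
      sqrtBeta N k lam 𝒳 B σ δ (n + 1) * postStd k lam x n z := by
  have h := abs_sub_postMean_le hH.kernel_eq_inner hlam f x y e n
    (fun a => by rw [inner_kerFun_one]; exact hy a a.2) z
  rw [inner_kerFun_one] at h
  refine h.trans (mul_le_mul_of_nonneg_right ?_ (Real.sqrt_nonneg _))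
  exact add_le_add hf he

end ReproducingKernel

end CONFIG

theorem mainTheorem4 {d N : ℕ}
    {Ω : Type*} [mΩ : MeasurableSpace Ω] (P : MeasureTheory.Measure Ω)
    [MeasureTheory.IsProbabilityMeasure P]
    -- the candidate set
    (𝒳 : Set (CONFIG.Pt d)) (h𝒳 : IsCompact 𝒳)
    -- the kernels, index `0` for the objective and `i.succ` for the constraints
    (k : Fin (N + 1) → CONFIG.Pt d → CONFIG.Pt d → ℝ)
    (hk_meas : ∀ i, Measurable (Function.uncurry (k i)))
    (hk_bdd : ∀ i, BddAbove ((fun z => k i z z) '' 𝒳))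
    -- their reproducing kernel Hilbert spaces
    (H : Fin (N + 1) → Type*) [∀ i, NormedAddCommGroup (H i)] [∀ i, InnerProductSpace ℝ (H i)]
    [∀ i, CompleteSpace (H i)] [∀ i, RKHS ℝ (H i) (CONFIG.Pt d) ℝ]
    (hH : ∀ i, CONFIG.IsRKHSOf (H i) (k i))
    -- the objective `F 0` and the constraint functions `F i.succ`
    (F : ∀ i, H i) (B : Fin (N + 1) → ℝ) (hF : ∀ i, ‖F i‖ ≤ B i)
    -- feasibility, with an optimal solution
    (xstar : CONFIG.Pt d) (hxstar : xstar ∈ CONFIG.solutionSet 𝒳 (fun i z => F i z))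
    -- model and noise parameters, confidence level
    (lam : ℝ) (hlam : 1 ≤ lam) (σ : NNReal) (δ : ℝ) (hδ0 : 0 < δ) (hδ1 : δ < 1)
    -- noise: at each step independent of the past, and `σ`-sub-Gaussian
    (𝓕 : MeasureTheory.Filtration ℕ mΩ) (ν : Fin (N + 1) → ℕ → Ω → ℝ)
    (hν_adapted : ∀ i t, Measurable[𝓕 (t + 1)] (ν i (t + 1)))
    (hν_indep : ∀ i t,
      ProbabilityTheory.Indep (MeasurableSpace.comap (ν i (t + 1)) inferInstance) (𝓕 t) P)
    (hν_subG : ∀ i t, ProbabilityTheory.HasSubgaussianMGF (ν i (t + 1)) (σ ^ 2) P)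
    -- query points, chosen on the basis of the past, and noisy observations
    (x : ℕ → Ω → CONFIG.Pt d) (hx : ∀ t, Measurable[𝓕 t] (x (t + 1)))
    (y : Fin (N + 1) → ℕ → Ω → ℝ)
    (hy : ∀ i t, 1 ≤ t → ∀ ω, y i t ω = F i (x t ω) + ν i t ω)
    (hrun : ∀ ω, CONFIG.IsRun k lam 𝒳 B σ δ (fun t => x t ω) (fun i t => y i t ω)) :
    ∃ A : Set Ω, MeasurableSet A ∧ ENNReal.ofReal (1 - δ) ≤ P A ∧
      ∀ ω ∈ A, ∀ t, 1 ≤ t →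
        -- infeasibility is not declared, and the query point is a solution of the auxiliary problem
        ¬ CONFIG.Declares 𝒳
            (CONFIG.lcbs k lam 𝒳 B σ δ (fun s => x s ω) (fun i s => y i s ω) t) ∧
        x t ω ∈ CONFIG.solutionSet 𝒳
            (CONFIG.lcbs k lam 𝒳 B σ δ (fun s => x s ω) (fun i s => y i s ω) t) ∧
        CONFIG.regret (fun z => F 0 z) (F 0 xstar) (x t ω)
          ≤ CONFIG.posRegret (fun z => F 0 z) (F 0 xstar) (x t ω) ∧
        CONFIG.posRegret (fun z => F 0 z) (F 0 xstar) (x t ω)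
          ≤ 2 * CONFIG.sqrtBeta N (k 0) lam 𝒳 (B 0) σ δ t *
              CONFIG.postStd (k 0) lam (fun s => x s ω) (t - 1) (x t ω) ∧
        ∀ i : Fin N,
          CONFIG.violation (fun z => F i.succ z) (x t ω)
            ≤ 2 * CONFIG.sqrtBeta N (k i.succ) lam 𝒳 (B i.succ) σ δ t *
                CONFIG.postStd (k i.succ) lam (fun s => x s ω) (t - 1) (x t ω) := by
  set C : ℝ := ((N : ℝ) + 1) / δ with hC
  have hN : (0 : ℝ) < N + 1 := by positivity
  have hCpos : 0 < C := div_pos hN hδ0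
  have hlam0 : 0 < lam := by linarith
  -- Level C = (N + 1)/δ leaves each function failure probability δ/(N + 1); the events are already
  -- uniform in n, so no union over time is taken.
  choose A hAm hAP hA using fun i => CONFIG.exists_event_sqrt_noiseEnergy_le
    (hH i).kernel_eq_inner hlam0 (hk_meas i) (hk_bdd i) σ (hν_adapted i) (hν_indep i)
    (hν_subG i) hx hCpos
  refine ⟨⋂ i, A i, MeasurableSet.iInter hAm, ?_, fun ω hω => ?_⟩
  · have hbad : P (⋂ i, A i)ᶜ ≤ ENNReal.ofReal δ := by
      rw [Set.compl_iInter]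
      calc P (⋃ i, (A i)ᶜ) ≤ ∑ i, P (A i)ᶜ := MeasureTheory.measure_iUnion_fintype_le _ _
        _ ≤ ∑ _i : Fin (N + 1), ENNReal.ofReal (1 / C) := Finset.sum_le_sum fun i _ => hAP i
        _ = ENNReal.ofReal δ := by
            rw [← ENNReal.ofReal_sum_of_nonneg fun _ _ => (one_div_pos.2 hCpos).le]
            congr 1
            rw [Finset.sum_const, Finset.card_univ, Fintype.card_fin, nsmul_eq_mul, hC]
            push_cast
            field_simp
    rw [← compl_compl (⋂ i, A i), MeasureTheory.prob_compl_eq_one_sub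
      (MeasurableSet.iInter hAm).compl, ENNReal.ofReal_sub _ hδ0.le, ENNReal.ofReal_one]
    exact tsub_le_tsub_left hbad 1
  have hB0 : ∀ i, 0 ≤ B i := fun i => (norm_nonneg _).trans (hF i)
  set X : ℕ → CONFIG.Pt d := fun s => x s ω with hX
  set l := CONFIG.lcbs k lam 𝒳 B σ δ X (fun i s => y i s ω) with hl
  -- Earlier queries must lie in 𝒳 for their information gain to be below the supremum over 𝒳.
  have hconf : ∀ n, (∀ t < n, X (t + 1) ∈ 𝒳) → ∀ i z,
      l (n + 1) i z ≤ F i z ∧ F i z ≤ l (n + 1) i z +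
        2 * CONFIG.sqrtBeta N (k i) lam 𝒳 (B i) σ δ (n + 1) *
          CONFIG.postStd (k i) lam X n z := by
    intro n hn i z
    have h := abs_le.1 (CONFIG.abs_sub_postMean_le_sqrtBeta_mul (hH i) hlam N (hF i)
      (x := X) (y := fun s => y i s ω) (e := fun s => ν i s ω)
      (fun t _ => hy i (t + 1) (Nat.le_add_left 1 t) ω)
      (hA i ω (Set.mem_iInter.1 hω i) n fun a => hn a a.2) z)
    have hlz : l (n + 1) i z = CONFIG.postMean (k i) lam X (fun s => y i s ω) n z -
        CONFIG.sqrtBeta N (k i) lam 𝒳 (B i) σ δ (n + 1) * CONFIG.postStd (k i) lam X n z := rfl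
    rw [hlz]
    constructor <;> linarith [h.1, h.2]
  have hmain : ∀ n, ¬ CONFIG.Declares 𝒳 (l (n + 1)) ∧
      X (n + 1) ∈ CONFIG.solutionSet 𝒳 (l (n + 1)) := by
    intro n
    -- Each step needs the previous queries to be in 𝒳, known only because they solved their
    -- auxiliary problems, and `IsRun` needs no declaration up to the current step.
    induction n using Nat.strong_induction_on with
    | _ n ih =>
      have hlow := fun i z => (hconf n (fun t ht => (ih t ht).2.1.1) i z).1
      have hnd := CONFIG.not_declares_of_le hlow hxstar.1
      refine ⟨hnd, hrun ω (n + 1) (Nat.le_add_left 1 n) (fun s hs hsn => ?_)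
        ⟨xstar, CONFIG.feasibleSet_subset_of_le hlow hxstar.1⟩⟩
      obtain ⟨m, rfl⟩ := Nat.exists_eq_add_of_le' hs
      rcases (Nat.le_of_succ_le_succ hsn).lt_or_eq with hm | rfl
      · exact (ih m hm).1
      · exact hnd
  intro t ht
  obtain ⟨n, rfl⟩ := Nat.exists_eq_add_of_le' ht
  obtain ⟨hnd, hsol⟩ := hmain n
  have hbound := hconf n fun t _ => (hmain t).2.1.1
  have hwidth : ∀ i z, 0 ≤ 2 * CONFIG.sqrtBeta N (k i) lam 𝒳 (B i) σ δ (n + 1) *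
      CONFIG.postStd (k i) lam X n z := fun i z =>
    mul_nonneg (mul_nonneg zero_le_two (CONFIG.sqrtBeta_nonneg N _ lam 𝒳 (hB0 i) σ.2 δ _))
      (Real.sqrt_nonneg _)
  refine ⟨hnd, hsol, le_max_left _ _, max_le ?_ (hwidth 0 _), fun i => max_le ?_ (hwidth _ _)⟩
  -- x* is a competitor in the auxiliary problem, so l_0(x_t) ≤ l_0(x*) ≤ f*.
  · have h1 := hsol.2 xstar
      (CONFIG.feasibleSet_subset_of_le (fun i z => (hbound i z).1) hxstar.1)
    have h2 := (hbound 0 xstar).1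
    have h3 := (hbound 0 (X (n + 1))).2
    exact sub_le_iff_le_add'.2 (h3.trans (add_le_add_left (h1.trans h2) _))
  · have h1 := hsol.1.2 i
    have h3 := (hbound i.succ (X (n + 1))).2
    exact h3.trans (add_le_of_nonpos_left h1)
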